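/- Let $\mathbb{H}[q_1,q_2]$ be the ring of slice regular polynomials $P(q_1,q_2)=\sum_{n,m} q_1^nq_2^m a_{n,m}$ ($a_{n,m}\in\mathbb{H}$) in two quaternionic variables, with the $*$-product determined by $(q_1^nq_2^ma)*(q_1^rq_2^sb)=q_1^{n+r}q_2^{m+s}ab$, and let $P,Q\in\mathbb{H}[q_1,q_2]$, not both zero. For a skew field $(\mathbb{F},+,*)$ let $\mathrm{Det}^*$ be the Dieudonné determinant of square matrices over $\mathbb{F}$, with values in $\mathbb{F}^\times/[\mathbb{F}^\times,\mathbb{F}^\times]\cup\{0\}$ (zero for non-invertible matrices). Let $\mathcal{L}(\mathbb{H})$ be the skew field of left quotients of the ring of slice regular functions $\sum_n q^na_n$ on $\mathbb{H}$ with the $*$-product $(q^na)*(q^mb)=q^{n+m}ab$; it contains $\mathbb{H}[q]$. Write $P=\sum_{k=0}^{n}q_1^k*P_k(q_2)$ and $Q=\sum_{k=0}^{m}q_1^k*Q_k(q_2)$ with $n=\deg_{q_1}P$, $m=\deg_{q_1}Q$ (the degree of the zero polynomial being taken as $0$), and let $A(q_2)$ be the $(n+m)\times(n+m)$ Sylvester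 matrix whose first $m$ columns are the successive downward shifts of $(P_0,\dots,P_n,0,\dots,0)^t$ and whose last $n$ columns are those of $(Q_0,\dots,Q_m,0,\dots,0)^t$. Put $\mathrm{Res}(P,Q;q_1):=\mathrm{Det}^*(A(q_2))$, the determinant being taken over $\mathcal{L}(\mathbb{H})$ in the variable $q_2$. Define $\mathrm{Res}(P,Q;q_2)$ in the same way from the expansions $P=\sum_k q_2^k*\tilde P_k(q_1)$, $Q=\sum_k q_2^k*\tilde Q_k(q_1)$, the determinant being taken over $\mathcal{L}(\mathbb{H})$ in the variable $q_1$. Let $a,b\in\mathbb{H}$. 1. If $P=(q_1-a)*P_1$ and $Q=(q_1-a)*Q_1$ for some $P_1,Q_1\in\mathbb{H}[q_1,q_2]$, then $\mathrm{Res}(P,Q;q_1)\equiv 0$. 2. If $P=(q_2-b)*P_2$ and $Q=(q_2-b)*Q_2$ for some $P_2,Q_2\in\mathbb{H}[q_1,q_2]$, then $\mathrm{Res}(P,Q;q_2)\equiv 0$. -/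

import Mathlib

open scoped Polynomial Quaternion nonZeroDivisors

noncomputable section

namespace SliceRegular

/-! ### Slice regular polynomials in one and two quaternionic variables -/

/-- The ring `(ℍ[q], +, *)` of slice regular polynomials `∑ qⁿ aₙ` in one quaternionic variable.
A polynomial is given by its coefficients. In Mathlib's polynomial ring over the
noncommutative ring `ℍ` the variable commutes with the coefficients, so that the `n`-th coefficient
of a product is `∑_{k ≤ n} a_k b_{n-k}`: its product is the `*`-product. -/
abbrev SRPoly : Type := (ℍ[ℝ])[X]

/-- The ring `(ℍ[q₁, q₂], +, *)` of slice regular polynomials `∑ q₁ⁿ q₂ᵐ aₙₘ`, seen as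
polynomials in `q₁` whose coefficients are polynomials in `q₂`: the coefficient `aₙₘ` of `P` is
`(P.coeff n).coeff m`. The product is the `*`-product,
`(q₁ⁿ q₂ᵐ a) * (q₁ʳ q₂ˢ b) = q₁ⁿ⁺ʳ q₂ᵐ⁺ˢ a b`. -/
abbrev SRPoly₂ : Type := SRPoly[X]

/-- The function `ℍ → ℍ`, `q ↦ ∑ qᵐ aₘ`, of a one-variable polynomial. -/
def SRPoly.toFun (p : SRPoly) (q : ℍ[ℝ]) : ℍ[ℝ] := p.sum fun m a => q ^ m * a

/-- The function `ℍ² → ℍ`, `(q₁, q₂) ↦ ∑ q₁ⁿ q₂ᵐ aₙₘ`, of a two-variable polynomial. -/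
def SRPoly₂.toFun (P : SRPoly₂) (q₁ q₂ : ℍ[ℝ]) : ℍ[ℝ] :=
  P.sum fun n p => q₁ ^ n * SRPoly.toFun p q₂

lemma coeff_eq_zero_of_real (c : ℕ → ℍ[ℝ]) (s : Finset ℕ)
    (h : ∀ t : ℝ, ∑ m ∈ s, (t : ℍ[ℝ]) ^ m * c m = 0) : ∀ m ∈ s, c m = 0 := by
  have key : ∀ l : ℍ[ℝ] →ₗ[ℝ] ℝ, ∀ m ∈ s, l (c m) = 0 := by
    intro l
    set r : ℝ[X] := ∑ m ∈ s, Polynomial.monomial m (l (c m)) with hr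
    have hr0 : r = 0 := by
      apply Polynomial.funext
      intro t
      have h2 := congrArg l (h t)
      rw [map_sum, map_zero] at h2
      rw [hr, Polynomial.eval_finsetSum, Polynomial.eval_zero, ← h2]
      refine Finset.sum_congr rfl fun m _ => ?_
      have : ((t : ℍ[ℝ]) ^ m * c m) = (t ^ m) • c m := by
        rw [← Quaternion.coe_pow, Quaternion.coe_mul_eq_smul]
      rw [this, map_smul, Polynomial.eval_monomial, smul_eq_mul, mul_comm]
    intro m hm
    have := congrArg (fun p => Polynomial.coeff p m) hr0
    simpa [hr, Polynomial.finsetSum_coeff, Polynomial.coeff_monomial, hm] using this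
  intro m hm
  ext
  · exact key (QuaternionAlgebra.reₗ _ _ _) m hm
  · exact key (QuaternionAlgebra.imIₗ _ _ _) m hm
  · exact key (QuaternionAlgebra.imJₗ _ _ _) m hm
  · exact key (QuaternionAlgebra.imKₗ _ _ _) m hm

/-- A two-variable slice regular polynomial is determined by its function `ℍ² → ℍ`: coefficients and
functions may be identified. -/
theorem SRPoly₂.eq_zero_of_toFun (P : SRPoly₂) (h : ∀ q₁ q₂, SRPoly₂.toFun P q₁ q₂ = 0) :
    P = 0 := by
  refine Polynomial.ext fun n => Polynomial.ext fun m => ?_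
  by_contra hne
  have hn : n ∈ P.support := by
    rw [Polynomial.mem_support_iff]
    intro h0
    simp [h0] at hne
  have h1 : ∀ t : ℝ, SRPoly.toFun (P.coeff n) (t : ℍ[ℝ]) = 0 := fun t =>
    coeff_eq_zero_of_real (fun n => SRPoly.toFun (P.coeff n) (t : ℍ[ℝ])) P.support
      (fun u => h u t) n hn
  have hm : m ∈ (P.coeff n).support := by
    rw [Polynomial.mem_support_iff]
    simpa using hne
  exact hne (by simpa using coeff_eq_zero_of_real (P.coeff n).coeff (P.coeff n).support h1 m hm)

/-- The variable `q₁`. -/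
def q₁ : SRPoly₂ := Polynomial.X

/-- The variable `q₂`. -/
def q₂ : SRPoly₂ := Polynomial.C Polynomial.X

/-- The constant polynomial `a`. -/
def const (a : ℍ[ℝ]) : SRPoly₂ := Polynomial.C (Polynomial.C a)

/-- `L` is a left factor of `P` in `(ℍ[q₁, q₂], +, *)`. -/
def IsLeftFactor (L P : SRPoly₂) : Prop := ∃ P₁ : SRPoly₂, P = L * P₁

/-- `P`, rewritten as `∑ q₂ᵐ * P̃ₘ(q₁)`, a polynomial in `q₂` (the outer variable)
whose coefficients are polynomials in `q₁` (the inner variable). -/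
def swapVars (P : SRPoly₂) : SRPoly[X] :=
  P.sum fun n p => p.sum fun m a => Polynomial.monomial m (Polynomial.monomial n a)

theorem coeff_coeff_swapVars (P : SRPoly₂) (m n : ℕ) :
    ((swapVars P).coeff m).coeff n = (P.coeff n).coeff m := by
  classical
  simp only [swapVars, Polynomial.sum_def, Polynomial.finsetSum_coeff, Polynomial.coeff_monomial]
  rw [Finset.sum_eq_single n]
  · rw [Finset.sum_eq_single m]
    · simp
    · intro k _ hk
      simp [hk]
    · intro hm
      simpa using hm
  · intro k _ hk
    refine Finset.sum_eq_zero fun j _ => ?_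
    split_ifs <;> simp [Polynomial.coeff_monomial, hk]
  · intro hn
    simp [Polynomial.notMem_support_iff.mp hn]

/-! ### Slice regular functions on `ℍ` and their skew field of quotients -/

lemma summable_mul (f g : PowerSeries ℍ[ℝ])
    (hf : ∀ r : ℝ, 0 ≤ r → Summable fun n => ‖PowerSeries.coeff n f‖ * r ^ n)
    (hg : ∀ r : ℝ, 0 ≤ r → Summable fun n => ‖PowerSeries.coeff n g‖ * r ^ n) (r : ℝ)
    (hr : 0 ≤ r) : Summable fun n => ‖PowerSeries.coeff n (f * g)‖ * r ^ n := by
  have hf' : Summable fun n => ‖‖PowerSeries.coeff n f‖ * r ^ n‖ := (hf r hr).norm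
  have hg' : Summable fun n => ‖‖PowerSeries.coeff n g‖ * r ^ n‖ := (hg r hr).norm
  refine Summable.of_nonneg_of_le (fun n => by positivity) (fun n => ?_)
    (summable_norm_sum_mul_antidiagonal_of_summable_norm hf' hg')
  refine le_trans ?_ (Real.le_norm_self _)
  rw [PowerSeries.coeff_mul]
  refine (mul_le_mul_of_nonneg_right (norm_sum_le _ _) (by positivity)).trans ?_
  rw [Finset.sum_mul]
  refine Finset.sum_le_sum fun p hp => ?_
  rw [← Finset.HasAntidiagonal.mem_antidiagonal.mp hp, pow_add]
  refine (mul_le_mul_of_nonneg_right (norm_mul_le _ _) (by positivity)).trans (le_of_eq ?_)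
  ring

/-- The ring `(𝒮ℛ(ℍ), +, *)` of slice regular functions on `ℍ`: power series `∑ qⁿ aₙ` converging
on all of `ℍ`, with the `*`-product (the product of formal power series with central variable). -/
def SRFun : Subring (PowerSeries ℍ[ℝ]) where
  carrier := {f | ∀ r : ℝ, 0 ≤ r → Summable fun n => ‖PowerSeries.coeff n f‖ * r ^ n}
  zero_mem' := by
    intro r _
    simp
  one_mem' := by
    intro r _
    refine summable_of_ne_finset_zero (s := {0}) fun n hn => ?_
    have : n ≠ 0 := by simpa using hn
    simp [PowerSeries.coeff_one, this]
  add_mem' := by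
    intro f g hf hg r hr
    refine Summable.of_nonneg_of_le (fun n => by positivity) (fun n => ?_)
      ((hf r hr).add (hg r hr))
    rw [map_add, ← add_mul]
    gcongr
    exact norm_add_le _ _
  neg_mem' := by
    intro f hf r hr
    simpa using hf r hr
  mul_mem' := fun {f g} hf hg => summable_mul f g hf hg

/-- The regular conjugate `fᶜ = ∑ qⁿ āₙ`. -/
def regConj (f : SRFun) : SRFun :=
  ⟨PowerSeries.mk fun n => star (PowerSeries.coeff n f.1), by
    intro r hr
    simpa using f.2 r hr⟩

/-- The symmetrization `fᶜ * f` has real coefficients, hence is central. -/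
theorem regConj_mul_self_comm (f g : SRFun) : (regConj f * f) * g = g * (regConj f * f) := by
  have hreal : ∀ n, ∃ t : ℝ, PowerSeries.coeff n (regConj f * f).1 = (t : ℍ[ℝ]) := by
    intro n
    have hs : star (PowerSeries.coeff n (regConj f * f).1)
        = PowerSeries.coeff n (regConj f * f).1 := by
      simp only [Subring.coe_mul, regConj, PowerSeries.coeff_mul, PowerSeries.coeff_mk,
        star_sum, star_mul, star_star]
      rw [← Finset.Nat.sum_antidiagonal_swap]
      simp
    exact ⟨_, Quaternion.star_eq_self.mp hs⟩
  apply Subtype.ext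
  refine PowerSeries.ext fun n => ?_
  change PowerSeries.coeff n ((regConj f * f).1 * g.1) = PowerSeries.coeff n (g.1 * (regConj f * f).1)
  rw [PowerSeries.coeff_mul, PowerSeries.coeff_mul, ← Finset.Nat.sum_antidiagonal_swap]
  refine Finset.sum_congr rfl fun p _ => ?_
  obtain ⟨t, ht⟩ := hreal p.2
  simp only [Prod.fst_swap, Prod.snd_swap, ht]
  exact Quaternion.coe_commutes t _

theorem regConj_ne_zero {f : SRFun} (hf : f ≠ 0) : regConj f ≠ 0 := by
  intro h
  refine hf (Subtype.ext (PowerSeries.ext fun n => ?_))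
  have := congrArg (fun g : SRFun => PowerSeries.coeff n g.1) h
  simpa [regConj] using this

/-- `𝒮ℛ(ℍ)` is a left Ore domain: `(sᶜ * s) * r = (r * sᶜ) * s`. -/
instance SRFun_oreSet : OreLocalization.OreSet (nonZeroDivisors SRFun) :=
  OreLocalization.oreSetOfNoZeroDivisors
    (fun r s => r * regConj s.1)
    (fun _ s => ⟨regConj s.1 * s.1, mem_nonZeroDivisors_of_ne_zero
      (mul_ne_zero (regConj_ne_zero (nonZeroDivisors.ne_zero s.2))
        (nonZeroDivisors.ne_zero s.2))⟩)
    (fun r s => by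
      show (regConj s.1 * s.1) * r = r * regConj s.1 * s.1
      rw [regConj_mul_self_comm, mul_assoc])

/-- The skew field `ℒ(ℍ) = {f⁻* * g}` of left quotients of slice regular functions on `ℍ`. -/
abbrev SRQuot : Type := OreLocalization (nonZeroDivisors SRFun) SRFun

/-- The inclusion of `ℍ[q]` in the ring of slice regular functions on `ℍ`. -/
def polyToFun : SRPoly →+* SRFun :=
  (Polynomial.coeToPowerSeries.ringHom (R := ℍ[ℝ])).codRestrict SRFun (by
    intro p r _
    refine summable_of_ne_finset_zero (s := p.support) fun n hn => ?_
    simp [Polynomial.notMem_support_iff.mp hn])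

/-- The inclusion `ℍ[q] ⊂ ℒ(ℍ)`. -/
def polyToQuot : SRPoly →+* SRQuot :=
  (OreLocalization.numeratorRingHom (S := nonZeroDivisors SRFun)).comp polyToFun

/-! ### The Dieudonné determinant -/

/-- The abelian quotient `F̄ = (F \ {0}) / [F \ {0}, F \ {0}]` of the multiplicative group of a skew
field, with the class of `0` added. -/
abbrev AbClass (F : Type*) [DivisionRing F] : Type _ := WithZero (Abelianization Fˣ)

open Classical in
/-- The class `[x]` of an element of the skew field `F`. -/
def abClass {F : Type*} [DivisionRing F] (x : F) : AbClass F :=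
  if h : x = 0 then 0 else ((Abelianization.of (Units.mk0 x h) : Abelianization Fˣ) : AbClass F)

open Classical in
/-- The Dieudonné determinant of a square matrix over a skew field, by Gaussian elimination on the
rows. If the first column is zero, the determinant is `0`. Otherwise let `A k 0` be the
first nonzero entry of this column; left multiples of the row `k` are subtracted from the other
rows so as to clear the first column, row `k` and the first column are deleted, and the determinant
of the remaining matrix is multiplied by the class of `(-1)ᵏ A k 0`. (The sign makes this the usual
determinant over commutative fields; over a skew field containing `ℍ` its class is `1`, as
`-1 = i j i⁻¹ j⁻¹`.) -/
def dieudonneDet {F : Type*} [DivisionRing F] :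
    {n : ℕ} → Matrix (Fin n) (Fin n) F → AbClass F
  | 0, _ => 1
  | _ + 1, A =>
    if h : ∃ k, A k 0 ≠ 0 then
      let k := Fin.find _ h
      abClass ((-1) ^ (k : ℕ) * A k 0) *
        dieudonneDet (Matrix.of fun i j =>
          A (k.succAbove i) j.succ - A (k.succAbove i) 0 * (A k 0)⁻¹ * A k j.succ)
    else 0

/-! ### The regular resultants -/

/-- The Sylvester matrix of `P = ∑_{k ≤ n} xᵏ P_k` and `Q = ∑_{k ≤ m} xᵏ Q_k`, where `n` and `m` are
the degrees in the outer variable `x`, with entries in the polynomial ring in the other variable.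
It has `m` columns with the shifted coefficients `P_0, …, P_n`, followed by `n` columns with the
shifted coefficients `Q_0, …, Q_m`. -/
def sylvesterMatrix (P Q : SRPoly[X]) :
    Matrix (Fin (Q.natDegree + P.natDegree)) (Fin (Q.natDegree + P.natDegree)) SRPoly :=
  Polynomial.sylvester Q P Q.natDegree P.natDegree

/-- The regular resultant `Res(P, Q; q₁)`: the determinant, over the skew field `ℒ(ℍ)` of
quotients in the variable `q₂`, of the Sylvester matrix with respect to `q₁`. -/
def res₁ (P Q : SRPoly₂) : AbClass SRQuot :=
  dieudonneDet ((sylvesterMatrix P Q).map polyToQuot)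

/-- The regular resultant `Res(P, Q; q₂)`: the determinant, over the skew field `ℒ(ℍ)` of
quotients in the variable `q₁`, of the Sylvester matrix with respect to `q₂`. -/
def res₂ (P Q : SRPoly₂) : AbClass SRQuot :=
  dieudonneDet ((sylvesterMatrix (swapVars P) (swapVars Q)).map polyToQuot)

end SliceRegular

end

/-!
If `P = (x - a) * P₁` in a ring `R[x]` with central variable, the coefficients
`P_k = P₁_{k-1} - a P₁_k` satisfy `∑ aᵏ P_k = 0`, by telescoping: evaluation at `a` with the powers
of `a` on the left kills the polynomials `(x - a) * r`. Hence, when `P` and `Q` share the left factor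
`x - a`, the row vector `(1, a, a², …)` is annihilated by every column of the Sylvester matrix
(`vecMul_sylvester_eq_zero`). The Dieudonné determinant is computed by row operations, so a nonzero
left null vector of the matrix is passed on to each Gaussian complement, and the determinant is zero
(`dieudonneDet_eq_zero_of_vecMul_eq_zero`). The matrix is not empty, since one of `P`, `Q` is
nonzero and hence of positive degree.

For the second variable, exchanging the variables carries a left factor `q₂ - b` to the left factor
`x - b` (`swapVars_mul`).
-/

open scoped Polynomial Quaternion nonZeroDivisors

namespace SliceRegular

/-! ### Left null vectors and the Dieudonné determinant -/

open Classical in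
/-- A matrix with a nontrivial left null vector has Dieudonné determinant zero: after a pivot row
`k` is chosen, the null vector without its entry `k` is a null vector of the Gaussian complement,
and it is still nonzero because the entry `k` is determined by the others. -/
theorem dieudonneDet_eq_zero_of_vecMul_eq_zero {F : Type*} [DivisionRing F] {n : ℕ}
    (A : Matrix (Fin n) (Fin n) F) (v : Fin n → F) (hv : v ≠ 0) (hA : Matrix.vecMul v A = 0) :
    dieudonneDet A = 0 := by
  induction n with
  | zero => exact absurd (Subsingleton.elim v 0) hv
  | succ n ih =>
    rw [dieudonneDet]
    split_ifs with h
    · set k := Fin.find _ h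
      have hpiv : A k 0 ≠ 0 := Fin.find_spec h
      have hcol (j : Fin (n + 1)) :
          v k * A k j + ∑ i, v (k.succAbove i) * A (k.succAbove i) j = 0 := by
        have := congrFun hA j
        simpa only [Matrix.vecMul, dotProduct, Fin.sum_univ_succAbove _ k, Pi.zero_apply] using this
      have hvk : v k = -(∑ i, v (k.succAbove i) * A (k.succAbove i) 0) * (A k 0)⁻¹ := by
        rw [← eq_neg_of_add_eq_zero_left (hcol 0), mul_assoc, mul_inv_cancel₀ hpiv, mul_one]
      refine mul_eq_zero_of_right _ (ih _ (fun i => v (k.succAbove i)) (fun h0 => hv ?_) ?_)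
      · funext i
        have hrest (i : Fin n) : v (k.succAbove i) = 0 := congrFun h0 i
        rcases eq_or_ne i k with rfl | hi
        · simp [hvk, hrest]
        · obtain ⟨j, rfl⟩ := Fin.exists_succAbove_eq hi
          exact hrest j
      · funext j
        have := hcol j.succ
        rw [hvk, neg_mul, neg_mul, Finset.sum_mul, Finset.sum_mul, neg_add_eq_sub,
          ← Finset.sum_sub_distrib] at this
        simpa only [Matrix.vecMul, dotProduct, Matrix.of_apply, mul_sub, mul_assoc,
          Pi.zero_apply] using this
    · rfl

/-! ### Left factors and the Sylvester matrix -/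

/-- Evaluation at `a` with the powers of `a` on the left vanishes on products `(X - a) * r`. -/
theorem sum_pow_mul_coeff_X_sub_C_mul {R : Type*} [Ring R] [Nontrivial R] (a : R) (r : R[X])
    (N : ℕ) (hN : ((Polynomial.X - Polynomial.C a) * r).natDegree < N) :
    ∑ i ∈ Finset.range N, a ^ i * ((Polynomial.X - Polynomial.C a) * r).coeff i = 0 := by
  have telescope (M : ℕ) :
      ∑ i ∈ Finset.range (M + 1), a ^ i * ((Polynomial.X - Polynomial.C a) * r).coeff i
        = -(a ^ (M + 1) * r.coeff M) := by
    induction M with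
    | zero => simp [sub_mul]
    | succ M ih =>
      rw [Finset.sum_range_succ, ih, sub_mul, Polynomial.coeff_sub, Polynomial.coeff_X_mul,
        Polynomial.coeff_C_mul, pow_succ a (M + 1)]
      noncomm_ring
  obtain ⟨M, rfl⟩ := Nat.exists_eq_add_one_of_ne_zero (Nat.ne_zero_of_lt hN)
  rw [telescope]
  rcases eq_or_ne r 0 with rfl | hr
  · simp
  · rw [(Polynomial.monic_X_sub_C a).natDegree_mul' hr, Polynomial.natDegree_X_sub_C] at hN
    simp [Polynomial.coeff_eq_zero_of_natDegree_lt (show r.natDegree < M by lia)]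

/-- The columns of the Sylvester matrix hold the coefficients of the polynomials `Xʲ P` and `Xʲ Q`,
of which `X - a` is still a left factor. -/
theorem vecMul_sylvester_eq_zero {R : Type*} [Ring R] [Nontrivial R] (a : R) (p q : R[X])
    (hp : ∃ r, p = (Polynomial.X - Polynomial.C a) * r)
    (hq : ∃ r, q = (Polynomial.X - Polynomial.C a) * r) :
    Matrix.vecMul (fun i : Fin (q.natDegree + p.natDegree) => a ^ (i : ℕ))
      (Polynomial.sylvester q p q.natDegree p.natDegree) = 0 := by
  have key (f : R[X]) (hf : ∃ r, f = (Polynomial.X - Polynomial.C a) * r) (j N : ℕ)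
      (hj : j + f.natDegree < N) :
      ∑ i : Fin N, a ^ (i : ℕ) *
        (if (i : ℕ) ∈ Set.Icc j (j + f.natDegree) then f.coeff (i - j) else 0) = 0 := by
    obtain ⟨r, hr⟩ := hf
    have hshift : Polynomial.X ^ j * f
        = (Polynomial.X - Polynomial.C a) * (Polynomial.X ^ j * r) := by
      rw [hr, ← mul_assoc, ← mul_assoc, Polynomial.X_pow_mul]
    have hdeg : (Polynomial.X ^ j * f).natDegree < N := by
      refine (Polynomial.natDegree_mul_le).trans_lt ?_
      rwa [Polynomial.natDegree_X_pow]
    have hsum := sum_pow_mul_coeff_X_sub_C_mul a (Polynomial.X ^ j * r) N (hshift ▸ hdeg)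
    rw [← hshift, Finset.sum_range] at hsum
    refine (Finset.sum_congr rfl fun i _ => ?_).trans hsum
    simp only [Polynomial.coeff_X_pow_mul', Set.mem_Icc]
    congr 1
    split_ifs with h₁ h₂ h₂
    · rfl
    · exact absurd h₁.1 h₂
    · exact (Polynomial.coeff_eq_zero_of_natDegree_lt (by lia)).symm
    · rfl
  funext j
  simp only [Matrix.vecMul, dotProduct, Polynomial.sylvester, Matrix.of_apply, Pi.zero_apply]
  induction j using Fin.addCases with
  | left j =>
    simp only [Fin.addCases_left]
    exact key p hp j _ (by lia)
  | right j =>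
    simp only [Fin.addCases_right]
    exact key q hq j _ (by lia)

theorem dieudonneDet_sylvesterMatrix_eq_zero (p q : SRPoly[X]) (hpq : p ≠ 0 ∨ q ≠ 0) (a : SRPoly)
    (hp : ∃ r, p = (Polynomial.X - Polynomial.C a) * r)
    (hq : ∃ r, q = (Polynomial.X - Polynomial.C a) * r) :
    dieudonneDet ((sylvesterMatrix p q).map polyToQuot) = 0 := by
  have hdeg (f : SRPoly[X]) (hf : ∃ r, f = (Polynomial.X - Polynomial.C a) * r) (h0 : f ≠ 0) :
      0 < f.natDegree := by
    obtain ⟨r, rfl⟩ := hf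
    rw [(Polynomial.monic_X_sub_C a).natDegree_mul' (right_ne_zero_of_mul h0),
      Polynomial.natDegree_X_sub_C]
    lia
  have hpos : 0 < q.natDegree + p.natDegree := by
    rcases hpq with h | h
    · exact Nat.add_pos_right _ (hdeg p hp h)
    · exact Nat.add_pos_left (hdeg q hq h) _
  refine dieudonneDet_eq_zero_of_vecMul_eq_zero _ (polyToQuot ∘ fun i : Fin _ => a ^ (i : ℕ))
    (fun h => ?_) ?_
  · simpa using congrFun h ⟨0, hpos⟩
  · funext j
    rw [← RingHom.map_vecMul, sylvesterMatrix, vecMul_sylvester_eq_zero a p q hp hq]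
    simp

/-! ### Exchanging the variables -/

theorem swapVars_mul (b : ℍ[ℝ]) (P : SRPoly₂) :
    swapVars ((q₂ - const b) * P)
      = (Polynomial.X - Polynomial.C (Polynomial.C b)) * swapVars P := by
  refine Polynomial.ext fun m => Polynomial.ext fun n => ?_
  rw [coeff_coeff_swapVars, q₂, const, ← Polynomial.C_sub, Polynomial.coeff_C_mul, sub_mul, sub_mul,
    Polynomial.coeff_sub, Polynomial.coeff_sub, Polynomial.coeff_sub, Polynomial.coeff_C_mul,
    Polynomial.coeff_C_mul, Polynomial.coeff_C_mul, coeff_coeff_swapVars]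
  cases m with
  | zero => simp
  | succ m => rw [Polynomial.coeff_X_mul, Polynomial.coeff_X_mul, coeff_coeff_swapVars]

theorem swapVars_ne_zero {P : SRPoly₂} (hP : P ≠ 0) : swapVars P ≠ 0 := by
  refine fun h => hP (Polynomial.ext fun n => Polynomial.ext fun m => ?_)
  rw [← coeff_coeff_swapVars, h]
  simp

end SliceRegular

theorem proposition4p6 (P Q : SliceRegular.SRPoly₂) (hPQ : P ≠ 0 ∨ Q ≠ 0) (a b : Quaternion ℝ) :
    (SliceRegular.IsLeftFactor (SliceRegular.q₁ - SliceRegular.const a) P ∧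
      SliceRegular.IsLeftFactor (SliceRegular.q₁ - SliceRegular.const a) Q →
        SliceRegular.res₁ P Q = 0) ∧
    (SliceRegular.IsLeftFactor (SliceRegular.q₂ - SliceRegular.const b) P ∧
      SliceRegular.IsLeftFactor (SliceRegular.q₂ - SliceRegular.const b) Q →
        SliceRegular.res₂ P Q = 0) := by
  refine ⟨fun ⟨hP, hQ⟩ =>
    SliceRegular.dieudonneDet_sylvesterMatrix_eq_zero P Q hPQ (Polynomial.C a) hP hQ, ?_⟩
  rintro ⟨⟨P₂, rfl⟩, ⟨Q₂, rfl⟩⟩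
  exact SliceRegular.dieudonneDet_sylvesterMatrix_eq_zero _ _
    (hPQ.imp SliceRegular.swapVars_ne_zero SliceRegular.swapVars_ne_zero) (Polynomial.C b)
    ⟨_, SliceRegular.swapVars_mul b P₂⟩ ⟨_, SliceRegular.swapVars_mul b Q₂⟩
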